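/- **Theorem 1.7 (Plancherel–Pólya inequality).** Let $E$ be a complex hilbertian space of finite dimension, let $F$ be a real hilbertian space of finite dimension with complexification $F_{\mathbb C}=F\oplus iF$ (with the induced hermitian norm) and dual $F'$, and let $\Phi\colon E\times E\to F_{\mathbb C}$ be a hermitian map, that is, linear in the first variable and with $\Phi(\zeta',\zeta)=\overline{\Phi(\zeta,\zeta')}$. Write $\Phi(\zeta)=\Phi(\zeta,\zeta)\in F$ and $\rho(\zeta,z)=\operatorname{Im}z-\Phi(\zeta)$ for $(\zeta,z)\in E\times F_{\mathbb C}$, and let $\mathcal M=\{(\zeta,z)\in E\times F_{\mathbb C}:\operatorname{Im}z=\Phi(\zeta)\}$. Let $\mathcal N=E\times F$, endowed with Lebesgue measure. For $f\colon E\times F_{\mathbb C}\to\mathbb C$ and $h\in F$ let $f_h\colon\mathcal N\to\mathbb C$, $$f_h(\zeta,x)=f(\zeta,x+i\Phi(\zeta)+ih),$$ be the restriction of $f$ to $\mathcal M+(0,ih)$, read on $\mathcal N$. For a compact convex subset $K$ of $F'$ (possibly empty) and $h\in F$ let $$H_K(h)=\sup_{\lambda\in -K}\langle\lambda,h\rangle\in[-\infty,\infty),$$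 with $H_\emptyset=-\infty$ and $e^{-\infty}=0$. For $p\in(0,\infty]$, let $\mathcal B^p_K(\mathcal N)$ be the set of the holomorphic functions $f$ on $E\times F_{\mathbb C}$ such that $f_0\in L^p(\mathcal N)$ and such that for every $\varepsilon>0$ there is a constant $C_\varepsilon>0$ with $$|f(\zeta,z)|\le C_\varepsilon\, e^{C_\varepsilon(|\zeta|^2+|\operatorname{Re}z|)+H_{K+\overline B_{F'}(0,\varepsilon)}(\rho(\zeta,z))}\qquad\text{for all }(\zeta,z)\in E\times F_{\mathbb C},$$ where $\overline B_{F'}(0,\varepsilon)$ is the closed ball of $F'$ with centre $0$ and radius $\varepsilon$. Then, for every compact convex subset $K$ of $F'$, every $p\in(0,\infty]$, every $f\in\mathcal B^p_K(\mathcal N)$ and every $h\in F$, $$\|f_h\|_{L^p(\mathcal N)}\le e^{H_K(h)}\,\|f_0\|_{L^p(\mathcal N)}.$$ -/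

import Mathlib

open Set MeasureTheory
open scoped Pointwise ENNReal

noncomputable section

/-- The complexification `F_ℂ = F ⊕ iF` of a real vector space `F`; `⟨x, y⟩` stands for
`x + iy`. -/
@[ext]
structure Complexification (F : Type*) where
  /-- the real part -/
  re : F
  /-- the imaginary part -/
  im : F

namespace Complexification

section Algebra

variable {F : Type*} [AddCommGroup F]

instance : Zero (Complexification F) := ⟨⟨0, 0⟩⟩
instance : Add (Complexification F) := ⟨fun z w => ⟨z.re + w.re, z.im + w.im⟩⟩
instance : Neg (Complexification F) := ⟨fun z => ⟨-z.re, -z.im⟩⟩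
instance : Sub (Complexification F) := ⟨fun z w => ⟨z.re - w.re, z.im - w.im⟩⟩
instance [Module ℝ F] : SMul ℂ (Complexification F) :=
  ⟨fun c z => ⟨c.re • z.re - c.im • z.im, c.re • z.im + c.im • z.re⟩⟩

@[simp] theorem zero_re : (0 : Complexification F).re = 0 := rfl
@[simp] theorem zero_im : (0 : Complexification F).im = 0 := rfl
@[simp] theorem add_re (z w : Complexification F) : (z + w).re = z.re + w.re := rfl
@[simp] theorem add_im (z w : Complexification F) : (z + w).im = z.im + w.im := rfl
@[simp] theorem neg_re (z : Complexification F) : (-z).re = -z.re := rfl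
@[simp] theorem neg_im (z : Complexification F) : (-z).im = -z.im := rfl
@[simp] theorem sub_re (z w : Complexification F) : (z - w).re = z.re - w.re := rfl
@[simp] theorem sub_im (z w : Complexification F) : (z - w).im = z.im - w.im := rfl
@[simp] theorem smul_re [Module ℝ F] (c : ℂ) (z : Complexification F) :
    (c • z).re = c.re • z.re - c.im • z.im := rfl
@[simp] theorem smul_im [Module ℝ F] (c : ℂ) (z : Complexification F) :
    (c • z).im = c.re • z.im + c.im • z.re := rfl

instance : AddCommGroup (Complexification F) where
  add_assoc a b c := by ext <;> simp [add_assoc]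
  zero_add a := by ext <;> simp
  add_zero a := by ext <;> simp
  add_comm a b := by ext <;> simp [add_comm]
  neg_add_cancel a := by ext <;> simp
  sub_eq_add_neg a b := by ext <;> simp [sub_eq_add_neg]
  nsmul := nsmulRec
  zsmul := zsmulRec

instance [Module ℝ F] : Module ℂ (Complexification F) where
  one_smul a := by ext <;> simp
  mul_smul a b z := by
    ext <;> simp only [smul_re, smul_im, Complex.mul_re, Complex.mul_im] <;> module
  smul_zero a := by ext <;> simp
  smul_add a z w := by
    ext <;> simp only [smul_re, smul_im, add_re, add_im] <;> module
  add_smul a b z := by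
    ext <;> simp only [smul_re, smul_im, add_re, add_im, Complex.add_re, Complex.add_im] <;> module
  zero_smul z := by ext <;> simp

/-- The conjugation `x + iy ↦ x - iy`. -/
def conj (z : Complexification F) : Complexification F := ⟨z.re, -z.im⟩

end Algebra

variable {F : Type*} [NormedAddCommGroup F] [InnerProductSpace ℝ F]

/-- The hermitian scalar product on `F_ℂ` that extends the scalar product of `F`
(conjugate-linear in the first variable, as usual in Mathlib). -/
@[reducible]
def innerCore : InnerProductSpace.Core ℂ (Complexification F) where
  inner z w := ⟨inner ℝ z.re w.re + inner ℝ z.im w.im, inner ℝ z.re w.im - inner ℝ z.im w.re⟩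
  conj_inner_symm z w := by
    apply Complex.ext <;>
      simp [real_inner_comm z.re w.re, real_inner_comm z.im w.im, real_inner_comm z.im w.re,
        real_inner_comm z.re w.im]
  re_inner_nonneg z := by
    have h1 : 0 ≤ inner ℝ z.re z.re := real_inner_self_nonneg
    have h2 : 0 ≤ inner ℝ z.im z.im := real_inner_self_nonneg
    exact add_nonneg h1 h2
  add_left z w v := by
    apply Complex.ext <;> simp [inner_add_left] <;> ring
  smul_left z w c := by
    apply Complex.ext <;>
      simp [inner_add_left, inner_sub_left, real_inner_smul_left] <;> ring
  definite z h := by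
    have h0 : inner ℝ z.re z.re + inner ℝ z.im z.im = 0 := congrArg Complex.re h
    have h1 : 0 ≤ inner ℝ z.re z.re := real_inner_self_nonneg
    have h2 : 0 ≤ inner ℝ z.im z.im := real_inner_self_nonneg
    ext
    · exact inner_self_eq_zero.1 (show inner ℝ z.re z.re = 0 by linarith)
    · exact inner_self_eq_zero.1 (show inner ℝ z.im z.im = 0 by linarith)

instance : NormedAddCommGroup (Complexification F) :=
  InnerProductSpace.Core.toNormedAddCommGroup (cd := innerCore)

instance : InnerProductSpace ℂ (Complexification F) :=
  InnerProductSpace.ofCore innerCore.toCore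

/-- `‖x + iy‖² = ‖x‖² + ‖y‖²`. -/
theorem norm_sq_eq (z : Complexification F) : ‖z‖ ^ 2 = ‖z.re‖ ^ 2 + ‖z.im‖ ^ 2 := by
  rw [@norm_sq_eq_re_inner ℂ, ← real_inner_self_eq_norm_sq, ← real_inner_self_eq_norm_sq]
  rfl

end Complexification

section Bernstein

variable {E F : Type*} [NormedAddCommGroup E] [InnerProductSpace ℂ E]
  [NormedAddCommGroup F] [InnerProductSpace ℝ F]

/-- A hermitian map `Φ : E × E → F_ℂ`: linear in the first variable, conjugate-linear in the
second one, and with `Φ(ζ', ζ)` equal to the conjugate of `Φ(ζ, ζ')`. -/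
structure HermitianMap (E F : Type*) [NormedAddCommGroup E] [InnerProductSpace ℂ E]
    [NormedAddCommGroup F] [InnerProductSpace ℝ F] where
  /-- the underlying sesquilinear map -/
  toMap : E →ₗ[ℂ] E →ₛₗ[starRingEnd ℂ] Complexification F
  conj_symm : ∀ ζ ζ' : E, toMap ζ' ζ = (toMap ζ ζ').conj

/-- `Φ(ζ) = Φ(ζ, ζ)`, as an element of `F`. -/
def HermitianMap.quad (Φ : HermitianMap E F) (ζ : E) : F := (Φ.toMap ζ ζ).re

/-- `Φ(ζ, ζ)` is real, so that `Φ.quad ζ` is all of it. -/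
theorem HermitianMap.im_apply_self (Φ : HermitianMap E F) (ζ : E) : (Φ.toMap ζ ζ).im = 0 := by
  have h : (Φ.toMap ζ ζ).im = -(Φ.toMap ζ ζ).im :=
    congrArg Complexification.im (Φ.conj_symm ζ ζ)
  have h2 : (2 : ℝ) • (Φ.toMap ζ ζ).im = 0 := by
    rw [two_smul]; nth_rewrite 1 [h]; simp
  exact (smul_eq_zero.1 h2).resolve_left two_ne_zero

/-- The quadratic CR submanifold `M = {(ζ, z) : Im z = Φ(ζ)}` of `E × F_ℂ`. -/
def quadraticCR (Φ : HermitianMap E F) : Set (E × Complexification F) :=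
  {w | w.2.im = Φ.quad w.1}

/-- `ρ(ζ, z) = Im z - Φ(ζ)`. -/
def crRho (Φ : HermitianMap E F) (ζ : E) (z : Complexification F) : F := z.im - Φ.quad ζ

/-- The parametrization `(ζ, x) ↦ (ζ, x + iΦ(ζ) + ih)` of the translate `M + (0, ih)` by
`N = E × F`. -/
def crLeaf (Φ : HermitianMap E F) (h : F) (ν : E × F) : E × Complexification F :=
  (ν.1, ⟨ν.2, Φ.quad ν.1 + h⟩)

theorem bijOn_crLeaf (Φ : HermitianMap E F) (h : F) :
    BijOn (crLeaf Φ h) univ ((fun w => w + ((0, ⟨0, h⟩) : E × Complexification F)) ''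
      quadraticCR Φ) := by
  refine ⟨?_, ?_, ?_⟩
  · rintro ⟨ζ, x⟩ -
    refine ⟨(ζ, ⟨x, Φ.quad ζ⟩), rfl, ?_⟩
    refine Prod.ext ?_ (Complexification.ext ?_ ?_) <;> simp [crLeaf]
  · rintro ⟨ζ, x⟩ - ⟨ζ', x'⟩ - H
    exact Prod.ext (congrArg (fun w => w.1) H) (congrArg (fun w => w.2.re) H)
  · rintro _ ⟨⟨ζ, z⟩, hz, rfl⟩
    have hz' : z.im = Φ.quad ζ := hz
    refine ⟨(ζ, z.re), mem_univ _, ?_⟩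
    refine Prod.ext ?_ (Complexification.ext ?_ ?_) <;> simp [crLeaf, hz']

/-- `f_h`, the restriction of `f` to `M + (0, ih)`, as a function on `N = E × F`. -/
def crRestrict (Φ : HermitianMap E F) (f : E × Complexification F → ℂ) (h : F) : E × F → ℂ :=
  fun ν => f (crLeaf Φ h ν)

/-- The supporting function `H_K(h) = sup_{λ ∈ -K} ⟨λ, h⟩`; it is `-∞` for `K = ∅`. -/
def supportingFunction (K : Set (StrongDual ℝ F)) (h : F) : EReal :=
  ⨆ l ∈ -K, ((l h : ℝ) : EReal)

/-- The modified space of entire functions of exponential type `K`. Here `EReal.exp` is the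
exponential with values in `[0, ∞]`, and `EReal.exp ⊥ = 0`. -/
def expType (Φ : HermitianMap E F) (K : Set (StrongDual ℝ F)) :
    Set (E × Complexification F → ℂ) :=
  {f | Differentiable ℂ f ∧ ∀ ε : ℝ, 0 < ε → ∃ C : ℝ, 0 < C ∧
    ∀ (ζ : E) (z : Complexification F),
      ‖f (ζ, z)‖ₑ ≤ ENNReal.ofReal C *
        EReal.exp (((C * (‖ζ‖ ^ 2 + ‖z.re‖) : ℝ) : EReal) +
          supportingFunction (K + Metric.closedBall 0 ε) (crRho Φ ζ z))}

/-- Lebesgue measure on a complex hilbertian space `E` of finite dimension: the Lebesgue measure of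
`E` as a real hilbertian space, with the scalar product `Re ⟨ζ, ζ'⟩`. -/
def complexLebesgue (E : Type*) [NormedAddCommGroup E] [InnerProductSpace ℂ E]
    [FiniteDimensional ℂ E] [MeasurableSpace E] [BorelSpace E] : Measure E :=
  letI : InnerProductSpace ℝ E := InnerProductSpace.complexToReal
  haveI : FiniteDimensional ℝ E := FiniteDimensional.complexToReal E
  volume

/-- Lebesgue measure on `N = E × F`. -/
def lebesgueN (E F : Type*) [NormedAddCommGroup E] [InnerProductSpace ℂ E]
    [FiniteDimensional ℂ E] [MeasurableSpace E] [BorelSpace E]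
    [NormedAddCommGroup F] [InnerProductSpace ℝ F] [FiniteDimensional ℝ F]
    [MeasurableSpace F] [BorelSpace F] : Measure (E × F) :=
  (complexLebesgue E).prod volume

/-- The Bernstein space `B^p_K(N)`; the space `L^p(N)` refers to the Lebesgue measure of
`N = E × F`. -/
def bernsteinSpace [FiniteDimensional ℂ E] [MeasurableSpace E] [BorelSpace E]
    [FiniteDimensional ℝ F] [MeasurableSpace F] [BorelSpace F]
    (Φ : HermitianMap E F) (p : ℝ≥0∞) (K : Set (StrongDual ℝ F)) :
    Set (E × Complexification F → ℂ) :=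
  {f | f ∈ expType Φ K ∧ MemLp (crRestrict Φ f 0) p (lebesgueN E F)}

end Bernstein

end

/-! Restrict `f` to the complex lines of direction `(0, h)` through the points of the CR manifold
(`crSlice`). Along such a line `ρ` equals `Im w • h`, so by `exists_norm_crSlice_le` each slice
grows in the upper half-plane like `e^{(a + ε) Im w}`, up to a factor exponential in `|Re w|`, where
`a = H_K(h)`. At `w = i` the slice gives `f_h`; at real `w` it gives a translate of `f_0`.

For finite `p` the slices need not be bounded on the real axis by the `L^p` norm, so the integral
comes first: `U(w) = ∫ |slice_ν(w)|^p dν` over a ball is log-subharmonic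
(`isLogSubharmonic_setIntegral`, from Jensen's formula), and translation invariance bounds it on the
real axis by `‖f_0‖_p^p`. Phragmén–Lindelöf (`IsLogSubharmonic.le_of_re_nonneg`) carries this bound
to `w = i` at the cost of `e^{p(a + ε)}`. Then `ε → 0` and the balls exhaust `E × F`. For `p = ∞`
the same argument runs on a single slice. -/

/-! ### Jensen's formula and log-subharmonic integrals -/

section SubMeanValue

open Metric Real

/-- Sub-mean value property of `‖g‖ ^ p`, for `g` holomorphic and every `p > 0`. -/
theorem norm_rpow_le_circleAverage {g : ℂ → ℂ} {c : ℂ} {r p : ℝ} (hp : 0 < p)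
    (hr : 0 < r) (hg : AnalyticOnNhd ℂ g (closedBall c r)) :
    ‖g c‖ ^ p ≤ circleAverage (fun w => ‖g w‖ ^ p) c r := by
  have hr' : |r| = r := abs_of_pos hr
  by_cases h0 : g c = 0
  · rw [h0, norm_zero, zero_rpow hp.ne']
    exact circleAverage_nonneg_of_nonneg fun _ _ => by positivity
  have hc : 0 < ‖g c‖ := norm_pos_iff.2 h0
  -- after this normalization, `log ‖g₁ c‖ = p⁻¹`
  set a : ℝ := exp p⁻¹ / ‖g c‖ with ha
  have ha0 : 0 < a := by positivity
  set g₁ : ℂ → ℂ := fun w => (a : ℂ) * g w with hg₁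
  have hnorm : ∀ w, ‖g₁ w‖ = a * ‖g w‖ := fun w => by
    simp [hg₁, abs_of_pos ha0]
  have hg₁a : AnalyticOnNhd ℂ g₁ (closedBall c |r|) := by
    rw [hr']; exact analyticOnNhd_const.mul hg
  have hg₁c : log ‖g₁ c‖ = p⁻¹ := by
    rw [hnorm, ha, div_mul_cancel₀ _ hc.ne', log_exp]
  -- In Jensen's formula the zeros in the disc contribute nonnegative terms, which are dropped.
  have hJ : p⁻¹ ≤ circleAverage (fun w => log ‖g₁ w‖) c r := by
    rw [hg₁a.circleAverage_log_norm hr.ne' (by simp [hg₁, ha0.ne', h0]), hg₁c]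
    refine le_add_of_nonneg_left (finsum_nonneg fun u => ?_)
    have hd : 0 ≤ MeromorphicOn.divisor g₁ (closedBall c |r|) u :=
      MeromorphicOn.AnalyticOnNhd.divisor_nonneg hg₁a u
    by_cases hu : u ∈ closedBall c |r|
    · refine mul_nonneg (by exact_mod_cast hd) ?_
      rw [hr', mem_closedBall, dist_comm, dist_eq_norm] at hu
      rcases eq_or_ne c u with rfl | hne
      · simp
      · have : 0 < ‖c - u‖ := norm_pos_iff.2 (sub_ne_zero.2 hne)
        refine log_nonneg ?_
        rw [← div_eq_mul_inv, le_div_iff₀ this]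
        linarith
    · simp [hu]
  -- Tangent line of the exponential, `s ≤ e^{s - 1}` with `s = p log ‖g₁ w‖`; the normalization
  -- makes `s = 1` at `c`, so nothing is lost there. At zeros of `g` the convention `log 0 = 0`
  -- makes both sides vanish.
  have hpt : ∀ w, ‖g c‖ ^ p * p * log ‖g₁ w‖ ≤ ‖g w‖ ^ p := by
    intro w
    rcases eq_or_ne (g w) 0 with hw | hw
    · simp only [hnorm, hw, norm_zero, mul_zero, log_zero]; positivity
    · have hw' : 0 < ‖g w‖ := norm_pos_iff.2 hw
      have h1 : ‖g w‖ ^ p = ‖g c‖ ^ p * exp (p * log ‖g₁ w‖ - 1) := by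
        rw [hnorm, ha, log_mul ha0.ne' hw'.ne', log_div (exp_pos _).ne' hc.ne', log_exp,
          rpow_def_of_pos hw', rpow_def_of_pos hc, ← exp_add]
        congr 1
        field_simp
        ring
      rw [h1, mul_assoc]
      gcongr
      linarith [add_one_le_exp (p * log ‖g₁ w‖ - 1)]
  have hint : CircleIntegrable (fun w => ‖g w‖ ^ p) c r := by
    refine ContinuousOn.circleIntegrable hr.le ?_
    refine ContinuousOn.rpow_const ?_ fun _ _ => Or.inr hp.le
    exact (hg.continuousOn.mono sphere_subset_closedBall).norm
  have hint' : CircleIntegrable (fun w => log ‖g₁ w‖) c r :=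
    (hg₁a.mono sphere_subset_closedBall).meromorphicOn.circleIntegrable_log_norm
  have hmono := circleAverage_mono (c := c) (R := r)
    (f₁ := fun w => (‖g c‖ ^ p * p) • log ‖g₁ w‖)
    (hint'.const_fun_smul (a := ‖g c‖ ^ p * p)) hint fun w _ => hpt w
  rw [circleAverage_fun_smul, smul_eq_mul] at hmono
  refine le_trans ?_ hmono
  calc ‖g c‖ ^ p = ‖g c‖ ^ p * p * p⁻¹ := by field_simp
    _ ≤ _ := by gcongr

/-- A nonnegative continuous function `U` is called log-subharmonic when `U |e^φ|` satisfies the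
sub-mean value inequality on every closed disc near which `φ` is holomorphic. -/
structure IsLogSubharmonic (U : ℂ → ℝ) : Prop where
  continuous : Continuous U
  nonneg : ∀ w, 0 ≤ U w
  le_circleAverage : ∀ (c : ℂ) (r : ℝ) (φ : ℂ → ℂ), 0 < r → AnalyticOnNhd ℂ φ (closedBall c r) →
    U c * exp (φ c).re ≤ circleAverage (fun w => U w * exp (φ w).re) c r

/-- The integral over a compact set of parameters of `‖G t ·‖ ^ p`, with `G t` entire, is
log-subharmonic. -/
theorem isLogSubharmonic_setIntegral {T : Type*} [TopologicalSpace T] [MeasurableSpace T]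
    [OpensMeasurableSpace T] [T2Space T] [SecondCountableTopology T]
    {μ : Measure T} [IsLocallyFiniteMeasure μ]
    {G : T → ℂ → ℂ} (hG : Continuous (Function.uncurry G)) (hd : ∀ t, Differentiable ℂ (G t))
    {s : Set T} (hs : IsCompact s) {p : ℝ} (hp : 0 < p) :
    IsLogSubharmonic fun w => ∫ t in s, ‖G t w‖ ^ p ∂μ where
  continuous := by
    refine continuous_parametric_integral_of_continuous (f := fun w t => ‖G t w‖ ^ p) ?_ hs
    exact (hG.comp continuous_swap).norm.rpow_const fun _ => Or.inr hp.le
  nonneg w := integral_nonneg fun t => by positivity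
  le_circleAverage c r φ hr hφ := by
    have hmem : ∀ θ, circleMap c r θ ∈ closedBall c r := fun θ =>
      circleMap_mem_closedBall c hr.le θ
    -- The weight is absorbed into the entire function: `|G|^p |e^φ| = |G e^{φ/p}|^p`.
    have hexp : ∀ t w, ‖G t w‖ ^ p * exp (φ w).re
        = ‖G t w * Complex.exp ((p⁻¹ : ℝ) * φ w)‖ ^ p := fun t w => by
      rw [norm_mul, mul_rpow (norm_nonneg _) (norm_nonneg _), Complex.norm_exp,
        Complex.re_ofReal_mul, ← exp_mul]
      congr 2
      field_simp
    have hcont : Continuous fun q : ℝ × T =>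
        ‖G q.2 (circleMap c r q.1)‖ ^ p * exp (φ (circleMap c r q.1)).re := by
      have h1 : Continuous fun θ : ℝ => φ (circleMap c r θ) :=
        hφ.continuousOn.comp_continuous (continuous_circleMap c r) hmem
      have h2 : Continuous fun q : ℝ × T => G q.2 (circleMap c r q.1) :=
        hG.comp (continuous_snd.prodMk ((continuous_circleMap c r).comp continuous_fst))
      have h3 := h1.comp (continuous_fst (X := ℝ) (Y := T))
      exact (h2.norm.rpow_const fun _ => Or.inr hp.le).mul
        (continuous_exp.comp (Complex.continuous_re.comp h3))
    have : Fact (μ s < ∞) := ⟨hs.measure_lt_top⟩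
    have hI : Integrable (fun q : ℝ × T =>
        ‖G q.2 (circleMap c r q.1)‖ ^ p * exp (φ (circleMap c r q.1)).re)
        ((volume.restrict (uIoc 0 (2 * π))).prod (μ.restrict s)) := by
      rw [Measure.prod_restrict]
      exact (hcont.continuousOn.integrableOn_compact (isCompact_uIcc.prod hs)).mono_set
        (prod_mono uIoc_subset_uIcc subset_rfl)
    have hc1 : ∀ w, (∫ t in s, ‖G t w‖ ^ p ∂μ) * exp (φ w).re
        = ∫ t in s, ‖G t w‖ ^ p * exp (φ w).re ∂μ := fun w => (integral_mul_const _ _).symm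
    simp only [hc1]
    rw [circleAverage_def, intervalIntegral_integral_swap hI, ← integral_smul]
    refine integral_mono ?_ ?_ fun t => ?_
    · refine ContinuousOn.integrableOn_compact hs ?_
      have : Continuous fun t => G t c := hG.comp (continuous_id.prodMk continuous_const)
      exact ((this.norm.rpow_const fun _ => Or.inr hp.le).mul continuous_const).continuousOn
    · refine Integrable.fun_smul _ ?_
      refine ContinuousOn.integrableOn_compact hs (Continuous.continuousOn ?_)
      exact intervalIntegral.continuous_parametric_intervalIntegral_of_continuous'
        (f := fun t θ => ‖G t (circleMap c r θ)‖ ^ p * exp (φ (circleMap c r θ)).re)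
        (hcont.comp continuous_swap) _ _
    · have := norm_rpow_le_circleAverage (g := fun w =>
        G t w * Complex.exp ((p⁻¹ : ℝ) * φ w)) (c := c) hp hr
        (((hd t).differentiableOn.analyticOnNhd isOpen_univ).mono (subset_univ _) |>.mul
          (analyticOnNhd_const.mul hφ).cexp)
      simp only [← hexp] at this
      exact this

end SubMeanValue

/-! ### Phragmén–Lindelöf principles for log-subharmonic functions -/

section PhragmenLindelof

open Metric Real Filter Topology

namespace IsLogSubharmonic

variable {U : ℂ → ℝ}

/-- Phragmén–Lindelöf principle: the growth of `U` on `Ω` is compensated by `e^{-ε Re φ}`. -/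
theorem le_of_frontier_le (hU : IsLogSubharmonic U) {Ω : Set ℂ} (hΩ : IsOpen Ω) {φ : ℂ → ℂ}
    (hφ : AnalyticOnNhd ℂ φ Ω) (hφc : ContinuousOn φ (closure Ω))
    (hφ0 : ∀ w ∈ closure Ω, 0 ≤ (φ w).re) {M : ℝ} (hM : ∀ w ∈ frontier Ω, U w ≤ M)
    (hgrowth : ∀ ε > 0, ∃ R, ∀ w ∈ closure Ω, R ≤ ‖w‖ → U w * exp (-ε * (φ w).re) ≤ M)
    {w : ℂ} (hw : w ∈ closure Ω) : U w ≤ M := by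
  have key : ∀ ε > 0, U w * exp (-ε * (φ w).re) ≤ M := by
    intro ε hε
    by_contra! hlt
    obtain ⟨R₀, hR₀⟩ := hgrowth ε hε
    set R := max R₀ ‖w‖
    set V : ℂ → ℝ := fun w => U w * exp (-ε * (φ w).re) with hV
    have hVc : ContinuousOn V (closure Ω) :=
      hU.continuous.continuousOn.mul
        ((continuousOn_const.mul (Complex.continuous_re.comp_continuousOn hφc)).rexp)
    set S := closure Ω ∩ closedBall (0 : ℂ) R
    have hS : IsCompact S := (isCompact_closedBall _ _).inter_left isClosed_closure
    have hwS : w ∈ S := ⟨hw, by simp [R]⟩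
    obtain ⟨m, hmS, hm⟩ := hS.exists_isMaxOn ⟨w, hwS⟩ (hVc.mono inter_subset_left)
    -- among the maximum points, take one with the largest real part
    have hS' : IsCompact (S ∩ {v | V m ≤ V v}) := by
      refine hS.of_isClosed_subset ?_ inter_subset_left
      exact (hVc.mono inter_subset_left).preimage_isClosed_of_isClosed hS.isClosed isClosed_Ici
    obtain ⟨m', ⟨hm'S, hm'V⟩, hm'⟩ :=
      hS'.exists_isMaxOn ⟨m, hmS, le_refl (V m)⟩ Complex.continuous_re.continuousOn
    have hmax : ∀ v ∈ S, V v ≤ V m' := fun v hv => (hm hv).trans hm'V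
    have hMm' : M < V m' := hlt.trans_le (hmax w hwS)
    have hm'Ω : m' ∈ Ω := by
      by_contra hn
      have hf : m' ∈ frontier Ω := by rw [hΩ.frontier_eq]; exact ⟨hm'S.1, hn⟩
      have h1 : exp (-ε * (φ m').re) ≤ 1 := by
        rw [exp_le_one_iff]; nlinarith [hφ0 m' hm'S.1]
      have := mul_le_of_le_one_right (hU.nonneg m') h1
      linarith [hM m' hf]
    have hm'R : ‖m'‖ < R := by
      by_contra! hn
      linarith [hR₀ m' hm'S.1 ((le_max_left _ _).trans hn)]
    have hopen : IsOpen (Ω ∩ ball (0 : ℂ) R) := hΩ.inter isOpen_ball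
    obtain ⟨r, hr, hrsub⟩ := nhds_basis_closedBall.mem_iff.1
      (hopen.mem_nhds ⟨hm'Ω, by simpa using hm'R⟩)
    have hrS : closedBall m' r ⊆ S := fun v hv =>
      ⟨subset_closure (hrsub hv).1, ball_subset_closedBall (hrsub hv).2⟩
    have hmean := hU.le_circleAverage m' r (fun v => (-ε : ℝ) * φ v) hr
      (analyticOnNhd_const.mul (hφ.mono fun v hv => (hrsub hv).1))
    simp only [Complex.re_ofReal_mul] at hmean
    change V m' ≤ circleAverage V m' r at hmean
    have hcont : Continuous fun θ => V (circleMap m' r θ) :=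
      hVc.comp_continuous (continuous_circleMap _ _) fun θ =>
        (hrS (circleMap_mem_closedBall m' hr.le θ)).1
    -- The point `m' + r` of the circle lies further right than `m'`, so by the choice of `m'` it is
    -- not a maximum point; by continuity the average drops strictly.
    have hstrict : circleAverage V m' r < V m' := by
      rw [← circleAverage_const (V m') m' r, circleAverage_def, circleAverage_def, smul_eq_mul,
        smul_eq_mul]
      refine mul_lt_mul_of_pos_left ?_ (by positivity)
      refine intervalIntegral.integral_lt_integral_of_continuousOn_of_le_of_exists_lt (by positivity)
        hcont.continuousOn continuousOn_const
        (fun θ _ => hmax _ (hrS (circleMap_mem_closedBall m' hr.le θ))) ⟨0, by simp [pi_pos.le], ?_⟩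
      by_contra! hn
      have h2 := hm' (show circleMap m' r 0 ∈ S ∩ {v | V m ≤ V v} from
        ⟨hrS (circleMap_mem_closedBall m' hr.le 0), hm'V.trans hn⟩)
      simp [circleMap] at h2
      linarith
    linarith
  have ht : Tendsto (fun ε : ℝ => U w * exp (-ε * (φ w).re)) (𝓝[>] 0)
      (𝓝 (U w * exp (-0 * (φ w).re))) := by
    refine Tendsto.mono_left (Continuous.tendsto ?_ 0) nhdsWithin_le_nhds
    fun_prop
  simpa using le_of_tendsto ht (eventually_mem_nhdsWithin.mono fun ε hε => key ε hε)

/-- Phragmén–Lindelöf principle on a subdomain of the right half-plane whose points `w` satisfy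
`|α arg w + γ| ≤ 3π/8`, for growth of order `β < α`. -/
theorem le_of_frontier_le_of_arg (hU : IsLogSubharmonic U) {Ω : Set ℂ} (hΩ : IsOpen Ω)
    (hre : ∀ w ∈ Ω, 0 < w.re) {α β γ : ℝ} (hβ : 0 ≤ β) (hαβ : β < α)
    (harg : ∀ w ∈ closure Ω, |w.arg * α + γ| ≤ 3 * π / 8)
    {M : ℝ} (hM0 : 0 < M) (hM : ∀ w ∈ frontier Ω, U w ≤ M) {B : ℝ}
    (hgrowth : ∀ w ∈ closure Ω, U w ≤ exp (B * ‖w‖ ^ β + B))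
    {w : ℂ} (hw : w ∈ closure Ω) : U w ≤ M := by
  have hα : 0 < α := hβ.trans_lt hαβ
  have hre' : ∀ w ∈ closure Ω, 0 ≤ w.re := fun w hw =>
    closure_minimal (fun w hw => (hre w hw).le)
      (isClosed_le continuous_const Complex.continuous_re) hw
  set c := Real.cos (3 * π / 8)
  have hc : 0 < c := cos_pos_of_mem_Ioo ⟨by linarith [pi_pos], by linarith [pi_pos]⟩
  -- This is `e^{iγ} w^α`. Its argument stays within `3π/8` of the positive axis, whence `Re φ ≥ c
  -- |w|^α`.
  set φ : ℂ → ℂ := fun w => (Real.cos γ + Real.sin γ * Complex.I) * w ^ (α : ℂ)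
  have hφre : ∀ w, (φ w).re = ‖w‖ ^ α * Real.cos (w.arg * α + γ) := fun w => by
    simp only [φ]
    rw [Complex.cpow_ofReal, Real.cos_add]
    simp only [Complex.mul_re, Complex.mul_im, Complex.add_re, Complex.add_im, Complex.ofReal_re,
      Complex.ofReal_im, Complex.I_re, Complex.I_im]
    ring
  have hφge : ∀ w ∈ closure Ω, ‖w‖ ^ α * c ≤ (φ w).re := fun w hw => by
    rw [hφre]
    gcongr
    rw [← Real.cos_abs (w.arg * α + γ)]
    exact cos_le_cos_of_nonneg_of_le_pi (abs_nonneg _) (by linarith [pi_pos]) (harg w hw)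
  refine hU.le_of_frontier_le hΩ (φ := φ) ?_ ?_ ?_ hM ?_ hw
  · refine analyticOnNhd_const.mul fun w hw => ?_
    exact analyticAt_id.cpow analyticAt_const (Or.inl (hre w hw))
  · refine continuousOn_const.mul fun w hw => ContinuousAt.continuousWithinAt ?_
    exact Complex.continuousAt_cpow_const_of_re_pos (Or.inl (hre' w hw)) (by simpa using hα)
  · exact fun w hw => le_trans (by positivity) (hφge w hw)
  · intro ε hε
    have ht : Tendsto (fun r : ℝ => ε * c * r ^ (α - β)) atTop atTop :=
      (tendsto_rpow_atTop (sub_pos.2 hαβ)).const_mul_atTop (by positivity)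
    -- Since `‖w‖ ^ β ≥ 1`, this threshold times `‖w‖ ^ β` dominates `B‖w‖ ^ β + B - log M`.
    obtain ⟨R, hR⟩ := eventually_atTop.1
      ((ht.eventually_ge_atTop (B + |B - log M|)).and (eventually_ge_atTop 1))
    refine ⟨R, fun w hw hwR => ?_⟩
    obtain ⟨h1, h2⟩ := hR ‖w‖ hwR
    have h3 : 1 ≤ ‖w‖ ^ β := one_le_rpow h2 hβ
    have h4 : ‖w‖ ^ α = ‖w‖ ^ (α - β) * ‖w‖ ^ β := by
      rw [← rpow_add (by linarith)]; congr 1; ring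
    calc U w * exp (-ε * (φ w).re)
        ≤ exp (B * ‖w‖ ^ β + B) * exp (-ε * (‖w‖ ^ α * c)) := by
          refine mul_le_mul (hgrowth w hw) (exp_le_exp.2 ?_) (exp_pos _).le (exp_pos _).le
          nlinarith [hφge w hw]
      _ = exp (B * ‖w‖ ^ β + B - ε * c * ‖w‖ ^ (α - β) * ‖w‖ ^ β) := by
          rw [← exp_add, h4]; congr 1; ring
      _ ≤ exp (log M) := by
          refine exp_le_exp.2 ?_
          have h5 := mul_le_mul_of_nonneg_right h1 (zero_le_one.trans h3)
          have h6 := mul_le_mul_of_nonneg_left h3 (abs_nonneg (B - log M))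
          nlinarith [le_abs_self (B - log M)]
      _ = M := exp_log hM0

/-- Phragmén–Lindelöf principle on the right half-plane, for `U` of exponential type and bounded on
the positive half-line. -/
theorem le_of_re_nonneg (hU : IsLogSubharmonic U) {M A B : ℝ} (hM0 : 0 < M)
    (hM : ∀ w : ℂ, w.re = 0 → U w ≤ M) (hA : ∀ w : ℂ, 0 ≤ w.re → w.im = 0 → U w ≤ A)
    (hB : ∀ w : ℂ, 0 ≤ w.re → U w ≤ exp (B * ‖w‖ + B)) {w : ℂ} (hw : 0 ≤ w.re) : U w ≤ M := by
  set A' := max M A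
  have hA' : 0 < A' := hM0.trans_le (le_max_left _ _)
  have hbdd : ∀ w : ℂ, 0 ≤ w.re → U w ≤ A' := by
    intro w hw
    have hclP : closure {w : ℂ | 0 < w.re ∧ 0 < w.im} = {w : ℂ | 0 ≤ w.re ∧ 0 ≤ w.im} := by
      have := Complex.closure_reProdIm (Ioi 0) (Ioi 0)
      rw [closure_Ioi] at this
      exact this
    have hclN : closure {w : ℂ | 0 < w.re ∧ w.im < 0} = {w : ℂ | 0 ≤ w.re ∧ w.im ≤ 0} := by
      have := Complex.closure_reProdIm (Ioi 0) (Iio 0)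
      rw [closure_Ioi, closure_Iio] at this
      exact this
    have hoP : IsOpen {w : ℂ | 0 < w.re ∧ 0 < w.im} :=
      (isOpen_lt continuous_const Complex.continuous_re).inter
        (isOpen_lt continuous_const Complex.continuous_im)
    have hoN : IsOpen {w : ℂ | 0 < w.re ∧ w.im < 0} :=
      (isOpen_lt continuous_const Complex.continuous_re).inter
        (isOpen_lt Complex.continuous_im continuous_const)
    rcases le_total 0 w.im with him | him
    · refine hU.le_of_frontier_le_of_arg hoP (fun w hw => hw.1) (α := 3 / 2) (β := 1)
        (γ := -(3 * π / 8)) zero_le_one (by norm_num) ?_ hA' ?_ (B := B) ?_ (w := w) ?_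
      · rw [hclP]
        rintro v ⟨hv1, hv2⟩
        have h1 := abs_le.1 (Complex.abs_arg_le_pi_div_two_iff.2 hv1)
        have h2 := Complex.arg_nonneg_iff.2 hv2
        rw [abs_le]
        constructor <;> linarith
      · rw [hoP.frontier_eq, hclP]
        rintro v ⟨⟨hv1, hv2⟩, hv3⟩
        rcases hv1.eq_or_lt with h | h
        · exact (hM v h.symm).trans (le_max_left _ _)
        · refine (hA v hv1 ?_).trans (le_max_right _ _)
          by_contra hne
          exact hv3 ⟨h, lt_of_le_of_ne hv2 (Ne.symm hne)⟩
      · rw [hclP]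
        exact fun v hv => by simpa using hB v hv.1
      · rw [hclP]; exact ⟨hw, him⟩
    · refine hU.le_of_frontier_le_of_arg hoN (fun w hw => hw.1) (α := 3 / 2) (β := 1)
        (γ := 3 * π / 8) zero_le_one (by norm_num) ?_ hA' ?_ (B := B) ?_ (w := w) ?_
      · rw [hclN]
        rintro v ⟨hv1, hv2⟩
        have h1 := abs_le.1 (Complex.abs_arg_le_pi_div_two_iff.2 hv1)
        have h2 : v.arg ≤ 0 := by
          rcases hv2.eq_or_lt with h | h
          · exact (Complex.arg_eq_zero_iff.2 ⟨hv1, h⟩).le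
          · exact (Complex.arg_neg_iff.2 h).le
        rw [abs_le]
        constructor <;> linarith
      · rw [hoN.frontier_eq, hclN]
        rintro v ⟨⟨hv1, hv2⟩, hv3⟩
        rcases hv1.eq_or_lt with h | h
        · exact (hM v h.symm).trans (le_max_left _ _)
        · refine (hA v hv1 ?_).trans (le_max_right _ _)
          by_contra hne
          exact hv3 ⟨h, lt_of_le_of_ne hv2 hne⟩
      · rw [hclN]
        exact fun v hv => by simpa using hB v hv.1
      · rw [hclN]; exact ⟨hw, him⟩
  have ho : IsOpen {w : ℂ | 0 < w.re} := isOpen_lt continuous_const Complex.continuous_re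
  have hcl : closure {w : ℂ | 0 < w.re} = {w : ℂ | 0 ≤ w.re} := Complex.closure_setOfPred_lt_re 0
  -- Now `U` is bounded, so order `1/2` suffices on the whole half-plane. Its frontier is only the
  -- imaginary axis, which improves `A'` to `M`.
  refine hU.le_of_frontier_le_of_arg ho (fun w hw => hw) (α := 1 / 2) (β := 0)
    (γ := 0) le_rfl (by norm_num) ?_ hM0 ?_ (B := |log A'|) ?_ (w := w) ?_
  · rw [hcl]
    intro v hv
    have h1 := abs_le.1 (Complex.abs_arg_le_pi_div_two_iff.2 hv)
    rw [abs_le]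
    constructor <;> linarith [pi_pos]
  · rw [Complex.frontier_setOfPred_lt_re]
    exact fun v hv => hM v hv
  · rw [hcl]
    intro v hv
    refine (hbdd v hv).trans ?_
    rw [rpow_zero, ← exp_log hA']
    refine exp_le_exp.2 ?_
    rw [log_exp]
    linarith [le_abs_self (log A'), abs_nonneg (log A')]
  · rw [hcl]; exact hw

end IsLogSubharmonic

/-- Plancherel–Pólya inequality for a compact family of entire functions of exponential type: the
integral over the family of `‖G t ·‖ ^ p` grows at most by the factor `e^{pa}` from the real axis
to `i`. -/
theorem setIntegral_norm_rpow_le_of_exponential_type {T : Type*} [TopologicalSpace T]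
    [MeasurableSpace T] [OpensMeasurableSpace T] [T2Space T] [SecondCountableTopology T]
    {μ : Measure T} [IsLocallyFiniteMeasure μ]
    {G : T → ℂ → ℂ} (hG : Continuous (Function.uncurry G)) (hd : ∀ t, Differentiable ℂ (G t))
    {s : Set T} (hs : IsCompact s) {p : ℝ} (hp : 0 < p) {a : ℝ}
    (hgrowth : ∀ ε > 0, ∃ C, 0 ≤ C ∧ ∀ t ∈ s, ∀ w : ℂ, 0 ≤ w.im →
      ‖G t w‖ ≤ exp (C * |w.re| + C + (a + ε) * w.im))
    {M : ℝ} (hM : ∀ x : ℝ, ∫ t in s, ‖G t x‖ ^ p ∂μ ≤ M) :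
    ∫ t in s, ‖G t Complex.I‖ ^ p ∂μ ≤ exp (p * a) * M := by
  have hM0 : 0 ≤ M := le_trans (integral_nonneg fun t => by positivity) (hM 0)
  have key : ∀ ε > 0, ∫ t in s, ‖G t Complex.I‖ ^ p ∂μ ≤ exp (p * (a + ε)) * M := by
    intro ε hε
    obtain ⟨C, hC, hCG⟩ := hgrowth ε hε
    -- Rotation to the right half-plane. The exponential factor cancels the growth along the
    -- positive half-line and has modulus one on the imaginary axis.
    set H : T → ℂ → ℂ := fun t w => G t (Complex.I * w) * Complex.exp (-(a + ε : ℝ) * w) with hH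
    have hnorm : ∀ t w, ‖H t w‖ = ‖G t (Complex.I * w)‖ * exp (-(a + ε) * w.re) := fun t w => by
      rw [hH, norm_mul, Complex.norm_exp, ← Complex.ofReal_neg, Complex.re_ofReal_mul]
    have hHc : Continuous (Function.uncurry H) := by
      have h1 : Continuous fun q : T × ℂ => G q.1 (Complex.I * q.2) :=
        hG.comp (continuous_fst.prodMk (continuous_const.mul continuous_snd))
      exact h1.mul (Complex.continuous_exp.comp (continuous_const.mul continuous_snd))
    have hHd : ∀ t, Differentiable ℂ (H t) := fun t =>
      ((hd t).comp (differentiable_id.const_mul _)).mul (differentiable_id.const_mul _).cexp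
    have hU := isLogSubharmonic_setIntegral (μ := μ) hHc hHd hs hp
    have hbound : ∀ w : ℂ, 0 ≤ w.re →
        ∫ t in s, ‖H t w‖ ^ p ∂μ ≤ exp (p * (C * |w.im| + C)) * μ.real s := by
      intro w hw
      refine (Real.le_norm_self _).trans
        (norm_setIntegral_le_of_norm_le_const hs.measure_lt_top fun t ht => ?_)
      rw [norm_of_nonneg (by positivity), mul_comm p, exp_mul]
      refine rpow_le_rpow (norm_nonneg _) ?_ hp.le
      rw [hnorm]
      have h1 := hCG t ht (Complex.I * w) (by simpa using hw)
      simp only [Complex.I_mul_re, Complex.I_mul_im, abs_neg] at h1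
      calc _ ≤ exp (C * |w.im| + C + (a + ε) * w.re) * exp (-(a + ε) * w.re) := by gcongr
        _ = _ := by rw [← exp_add]; congr 1; ring
    refine le_of_forall_pos_le_add fun δ hδ => ?_
    -- `M` may vanish while Phragmén–Lindelöf needs a positive bound; this choice makes the final
    -- error `δ`.
    set δ' := δ / exp (p * (a + ε)) with hδ'
    have hδ'0 : 0 < δ' := by positivity
    have h1 := hU.le_of_re_nonneg (M := M + δ') (A := exp (p * C) * μ.real s)
      (B := p * C + μ.real s) (by positivity) ?_ ?_ ?_ (w := 1) (by simp)
    · have h2 : ∀ t, ‖G t Complex.I‖ ^ p = exp (p * (a + ε)) * ‖H t 1‖ ^ p := fun t => by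
        rw [hnorm, mul_rpow (norm_nonneg _) (exp_pos _).le, ← exp_mul, mul_one, Complex.one_re,
          mul_left_comm, ← exp_add]
        ring_nf
        simp
      simp only [h2, integral_const_mul]
      calc _ ≤ exp (p * (a + ε)) * (M + δ') := by gcongr
        _ = _ := by rw [hδ']; field_simp
    · intro w hw
      refine le_trans (le_of_eq ?_) ((hM (-w.im)).trans (by linarith))
      have h3 : Complex.I * w = ((-w.im : ℝ) : ℂ) := by
        apply Complex.ext <;> simp [hw]
      simp only [hnorm, hw, h3, mul_zero, exp_zero, mul_one]
    · intro w hw hw'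
      simpa [hw'] using hbound w hw
    · intro w hw
      refine (hbound w hw).trans ?_
      -- The mass of `s` is turned into an exponential to fit the form `exp (B * ‖w‖ + B)`.
      have h4 : μ.real s ≤ exp (μ.real s * ‖w‖ + μ.real s) := by
        have := add_one_le_exp (μ.real s * ‖w‖ + μ.real s)
        have : 0 ≤ μ.real s * ‖w‖ := by positivity
        linarith
      calc _ ≤ exp (p * (C * ‖w‖ + C)) * exp (μ.real s * ‖w‖ + μ.real s) := by
            gcongr
            exact Complex.abs_im_le_norm w
        _ = _ := by rw [← exp_add]; congr 1; ring
  have ht : Tendsto (fun ε : ℝ => exp (p * (a + ε)) * M) (𝓝[>] 0)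
      (𝓝 (exp (p * (a + 0)) * M)) := by
    refine Tendsto.mono_left (Continuous.tendsto ?_ 0) nhdsWithin_le_nhds
    fun_prop
  simpa using ge_of_tendsto ht (eventually_mem_nhdsWithin.mono fun ε hε => key ε hε)

end PhragmenLindelof

/-! ### Slices along complex lines and their exponential type -/

section Slices

open Filter Topology

theorem Complexification.real_smul_re {F : Type*} [NormedAddCommGroup F] [InnerProductSpace ℝ F]
    (c : ℝ) (z : Complexification F) : (c • z).re = c • z.re := by
  rw [← Complex.coe_smul, Complexification.smul_re]
  simp

theorem Complexification.real_smul_im {F : Type*} [NormedAddCommGroup F] [InnerProductSpace ℝ F]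
    (c : ℝ) (z : Complexification F) : (c • z).im = c • z.im := by
  rw [← Complex.coe_smul, Complexification.smul_im]
  simp

theorem Complexification.continuous_mk {F : Type*} [NormedAddCommGroup F] [InnerProductSpace ℝ F]
    [FiniteDimensional ℝ F] : Continuous fun q : F × F => (⟨q.1, q.2⟩ : Complexification F) := by
  let L : F × F →ₗ[ℝ] Complexification F :=
    { toFun := fun q => ⟨q.1, q.2⟩
      map_add' := fun _ _ => rfl
      map_smul' := fun c q => by
        ext <;> simp [real_smul_re, real_smul_im] }
  exact L.continuous_of_finiteDimensional

variable {E F : Type*} [NormedAddCommGroup E] [InnerProductSpace ℂ E]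
  [NormedAddCommGroup F] [InnerProductSpace ℝ F]

theorem HermitianMap.continuous_quad [FiniteDimensional ℂ E] (Φ : HermitianMap E F) :
    Continuous Φ.quad := by
  have : FiniteDimensional ℝ E := FiniteDimensional.complexToReal E
  let B : E →ₗ[ℝ] E →ₗ[ℝ] F := LinearMap.mk₂ ℝ (fun ζ ζ' => (Φ.toMap ζ ζ').re)
    (fun ζ₁ ζ₂ ζ' => by simp) (fun c ζ ζ' => by
      rw [← Complex.coe_smul, map_smul, LinearMap.smul_apply, Complex.coe_smul,
        Complexification.real_smul_re])
    (fun ζ ζ₁ ζ₂ => by simp) (fun c ζ ζ' => by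
      rw [← Complex.coe_smul, map_smulₛₗ, Complex.conj_ofReal, Complex.coe_smul,
        Complexification.real_smul_re])
  exact B.toContinuousBilinearMap.continuous.clm_apply continuous_id

/-- The restriction `w ↦ f (ζ, x + iΦ(ζ) + w h)` of `f` to the complex line of direction `(0, h)`
through the point `(ζ, x + iΦ(ζ))`. -/
def crSlice (Φ : HermitianMap E F) (f : E × Complexification F → ℂ) (h : F) (ν : E × F) (w : ℂ) :
    ℂ :=
  f (ν.1, ⟨ν.2 + w.re • h, Φ.quad ν.1 + w.im • h⟩)

theorem crSlice_I (Φ : HermitianMap E F) (f : E × Complexification F → ℂ) (h : F) (ν : E × F) :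
    crSlice Φ f h ν Complex.I = crRestrict Φ f h ν := by
  simp [crSlice, crRestrict, crLeaf]

/-- Real translations preserve the CR manifold, so only `f_0` enters on the real axis, up to a
measure-preserving shift of `E × F`. -/
theorem crSlice_ofReal (Φ : HermitianMap E F) (f : E × Complexification F → ℂ) (h : F)
    (ν : E × F) (x : ℝ) : crSlice Φ f h ν x = crRestrict Φ f 0 (ν + (0, x • h)) := by
  simp [crSlice, crRestrict, crLeaf]

theorem differentiable_crSlice (Φ : HermitianMap E F) {f : E × Complexification F → ℂ}
    (hf : Differentiable ℂ f) (h : F) (ν : E × F) : Differentiable ℂ (crSlice Φ f h ν) := by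
  have h1 : crSlice Φ f h ν = fun w : ℂ => f (ν.1,
      (⟨ν.2, Φ.quad ν.1⟩ : Complexification F) + w • (⟨h, 0⟩ : Complexification F)) := by
    funext w
    unfold crSlice
    congr 2
    ext <;> simp
  rw [h1]
  exact hf.comp ((differentiable_const _).prodMk
    ((differentiable_id.smul_const _).const_add _))

theorem continuous_crSlice [FiniteDimensional ℂ E] [FiniteDimensional ℝ F]
    (Φ : HermitianMap E F) {f : E × Complexification F → ℂ} (hf : Continuous f) (h : F) :
    Continuous (Function.uncurry (crSlice Φ f h)) := by
  have hq := Φ.continuous_quad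
  refine hf.comp ((continuous_fst.comp continuous_fst).prodMk
    (Complexification.continuous_mk.comp (Continuous.prodMk ?_ ?_)))
  · exact (continuous_snd.comp continuous_fst).add
      ((Complex.continuous_re.comp continuous_snd).smul continuous_const)
  · exact (hq.comp (continuous_fst.comp continuous_fst)).add
      ((Complex.continuous_im.comp continuous_snd).smul continuous_const)

theorem continuous_crRestrict [FiniteDimensional ℂ E] [FiniteDimensional ℝ F]
    (Φ : HermitianMap E F) {f : E × Complexification F → ℂ} (hf : Continuous f) (h : F) :
    Continuous (crRestrict Φ f h) := by
  simp only [← funext (crSlice_I Φ f h)]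
  exact (continuous_crSlice Φ hf h).comp (continuous_id.prodMk continuous_const)

/-- Supporting functions are additive in the set and positively homogeneous in the vector, and the
ball contributes at most `ε * ‖h‖`. Multiples `v • h` suffice because `ρ` takes only such values on
a slice. -/
theorem supportingFunction_add_closedBall_smul_le {K : Set (StrongDual ℝ F)} {h : F} {a : ℝ}
    (ha : ∀ l ∈ -K, l h ≤ a) (ε : ℝ) {v : ℝ} (hv : 0 ≤ v) :
    supportingFunction (K + Metric.closedBall 0 ε) (v • h) ≤ ((v * (a + ε * ‖h‖) : ℝ) : EReal) := by
  refine iSup₂_le fun l hl => ?_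
  rw [Set.mem_neg] at hl
  obtain ⟨k, hk, b, hb, hkb⟩ := hl
  rw [mem_closedBall_zero_iff] at hb
  have h1 := ha (-k) (by simpa using hk)
  have h2 : -(b h) ≤ ε * ‖h‖ := (neg_le_abs _).trans
    ((b.le_opNorm h).trans (mul_le_mul_of_nonneg_right hb (norm_nonneg h)))
  have h3 : l = -k + -b := by rw [← neg_add, ← neg_eq_iff_eq_neg]; exact hkb.symm
  rw [EReal.coe_le_coe_iff, map_smul, smul_eq_mul, h3]
  refine mul_le_mul_of_nonneg_left ?_ hv
  simp only [add_apply, neg_apply] at h1 ⊢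
  linarith

/-- The slices of a function of exponential type `K`, on a bounded set of base points, are of
exponential type on the upper half-plane. -/
theorem exists_norm_crSlice_le {Φ : HermitianMap E F} {K : Set (StrongDual ℝ F)}
    {f : E × Complexification F → ℂ} (hf : f ∈ expType Φ K) {h : F} {a : ℝ}
    (ha : ∀ l ∈ -K, l h ≤ a) (R : ℝ) {ε : ℝ} (hε : 0 < ε) :
    ∃ C, 0 ≤ C ∧ ∀ ν : E × F, ‖ν‖ ≤ R → ∀ w : ℂ, 0 ≤ w.im →
      ‖crSlice Φ f h ν w‖ ≤ Real.exp (C * |w.re| + C + (a + ε) * w.im) := by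
  -- With this radius the ball contributes at most `ε` in the direction `h`; the `+ 1` allows `h =
  -- 0`.
  have hε' : 0 < ε / (‖h‖ + 1) := by positivity
  obtain ⟨C, hC, hCf⟩ := hf.2 _ hε'
  -- The terms account for the real displacement `w.re • h`, the base point, and the prefactor `C ≤
  -- e^C`.
  refine ⟨C * ‖h‖ + C * (R ^ 2 + |R|) + C, by positivity, fun ν hν w hw => ?_⟩
  have hν1 : ‖ν.1‖ ≤ R := (norm_fst_le ν).trans hν
  have hν2 : ‖ν.2‖ ≤ R := (norm_snd_le ν).trans hν
  have hrho : crRho Φ ν.1 ⟨ν.2 + w.re • h, Φ.quad ν.1 + w.im • h⟩ = w.im • h := by simp [crRho]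
  have h1 := hCf ν.1 ⟨ν.2 + w.re • h, Φ.quad ν.1 + w.im • h⟩
  rw [hrho] at h1
  have h2 := h1.trans (mul_le_mul_right (EReal.exp_monotone (add_le_add_right
    (supportingFunction_add_closedBall_smul_le ha _ hw) _)) _)
  rw [← EReal.coe_add, EReal.exp_coe, ← ENNReal.ofReal_mul hC.le, ← ofReal_norm,
    ENNReal.ofReal_le_ofReal_iff (by positivity)] at h2
  refine h2.trans ?_
  have h3 : C ≤ Real.exp C := by linarith [Real.add_one_le_exp C]
  have h4 : ε / (‖h‖ + 1) * ‖h‖ ≤ ε := by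
    rw [div_mul_eq_mul_div, div_le_iff₀ (by positivity)]
    nlinarith [norm_nonneg h]
  have h5 : ‖ν.2 + w.re • h‖ ≤ |R| + |w.re| * ‖h‖ := by
    refine (norm_add_le _ _).trans (add_le_add (hν2.trans (le_abs_self R)) ?_)
    rw [norm_smul, Real.norm_eq_abs]
  have h6 : ‖ν.1‖ ^ 2 ≤ R ^ 2 := by gcongr
  calc _ ≤ Real.exp C * Real.exp (C * (R ^ 2 + (|R| + |w.re| * ‖h‖)) + w.im * (a + ε)) := by gcongr
    _ ≤ _ := by
      rw [← Real.exp_add, Real.exp_le_exp]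
      have h7 : 0 ≤ (C * (R ^ 2 + |R|) + C) * |w.re| := by positivity
      have h8 : 0 ≤ C * ‖h‖ := by positivity
      nlinarith

/-- Plancherel–Pólya inequality for the supremum norm, pointwise. -/
theorem norm_crRestrict_le {Φ : HermitianMap E F} {K : Set (StrongDual ℝ F)}
    {f : E × Complexification F → ℂ} (hf : f ∈ expType Φ K) {h : F} {a : ℝ}
    (ha : ∀ l ∈ -K, l h ≤ a) {M : ℝ} (hM : ∀ ν, ‖crRestrict Φ f 0 ν‖ ≤ M) (ν : E × F) :
    ‖crRestrict Φ f h ν‖ ≤ Real.exp a * M := by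
  -- A single slice is a family over one point with Dirac mass; `p = 1` leaves the norm itself.
  have hmain := setIntegral_norm_rpow_le_of_exponential_type (T := Unit)
    (μ := Measure.dirac ()) (G := fun _ => crSlice Φ f h ν) (s := univ) (p := 1) (a := a) (M := M)
    ((differentiable_crSlice Φ hf.1 h ν).continuous.comp continuous_snd)
    (fun _ => differentiable_crSlice Φ hf.1 h ν) isCompact_univ one_pos
    (fun ε hε => by
      obtain ⟨C, hC, hCf⟩ := exists_norm_crSlice_le hf ha ‖ν‖ hε
      exact ⟨C, hC, fun _ _ => hCf ν le_rfl⟩)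
    (fun x => by simpa [crSlice_ofReal] using hM _)
  simpa [crSlice_I] using hmain

end Slices

/-! ### Integration over the base points -/

section PlancherelPolya

open Filter Topology

instance isAddHaarMeasure_complexLebesgue {E : Type*} [NormedAddCommGroup E]
    [InnerProductSpace ℂ E] [FiniteDimensional ℂ E] [MeasurableSpace E] [BorelSpace E] :
    (complexLebesgue E).IsAddHaarMeasure := by
  let _ : InnerProductSpace ℝ E := InnerProductSpace.complexToReal
  have : FiniteDimensional ℝ E := FiniteDimensional.complexToReal E
  exact inferInstanceAs (volume : Measure E).IsAddHaarMeasure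

variable {E F : Type*} [NormedAddCommGroup E] [InnerProductSpace ℂ E] [FiniteDimensional ℂ E]
  [MeasurableSpace E] [BorelSpace E]
  [NormedAddCommGroup F] [InnerProductSpace ℝ F] [FiniteDimensional ℝ F]
  [MeasurableSpace F] [BorelSpace F]

instance isAddHaarMeasure_lebesgueN : (lebesgueN E F).IsAddHaarMeasure := by
  have : ProperSpace E := FiniteDimensional.proper ℂ E
  unfold lebesgueN
  infer_instance

/-- Plancherel–Pólya inequality for finite exponents. -/
theorem lintegral_crRestrict_rpow_le {Φ : HermitianMap E F} {K : Set (StrongDual ℝ F)}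
    {f : E × Complexification F → ℂ} (hf : f ∈ expType Φ K) {h : F} {a : ℝ}
    (ha : ∀ l ∈ -K, l h ≤ a) {p : ℝ} (hp : 0 < p)
    (hfin : ∫⁻ ν, ‖crRestrict Φ f 0 ν‖ₑ ^ p ∂lebesgueN E F ≠ ∞) :
    ∫⁻ ν, ‖crRestrict Φ f h ν‖ₑ ^ p ∂lebesgueN E F ≤
      ENNReal.ofReal (Real.exp (p * a)) * ∫⁻ ν, ‖crRestrict Φ f 0 ν‖ₑ ^ p ∂lebesgueN E F := by
  have : ProperSpace E := FiniteDimensional.proper ℂ E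
  have hfc : Continuous f := hf.1.continuous
  set I := ∫⁻ ν, ‖crRestrict Φ f 0 ν‖ₑ ^ p ∂lebesgueN E F
  have hlint : ∀ (s : Set (E × F)), IsCompact s → ∀ w : ℂ,
      ENNReal.ofReal (∫ ν in s, ‖crSlice Φ f h ν w‖ ^ p ∂lebesgueN E F)
        = ∫⁻ ν in s, ‖crSlice Φ f h ν w‖ₑ ^ p ∂lebesgueN E F := by
    intro s hs w
    have hc : Continuous fun ν => ‖crSlice Φ f h ν w‖ ^ p :=
      ((continuous_crSlice Φ hfc h).comp
        (continuous_id.prodMk continuous_const)).norm.rpow_const fun _ => Or.inr hp.le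
    rw [ofReal_integral_eq_lintegral_ofReal (hc.continuousOn.integrableOn_compact hs)
      (ae_of_all _ fun ν => by positivity)]
    refine lintegral_congr fun ν => ?_
    rw [← ofReal_norm, ENNReal.ofReal_rpow_of_nonneg (norm_nonneg _) hp.le]
  -- The growth constants of the slices are uniform only over bounded sets of base points, hence the
  -- exhaustion by balls.
  have hball : ∀ n : ℕ, ∫⁻ ν in Metric.closedBall 0 n, ‖crRestrict Φ f h ν‖ₑ ^ p ∂lebesgueN E F ≤
      ENNReal.ofReal (Real.exp (p * a)) * I := by
    intro n
    have hs : IsCompact (Metric.closedBall (0 : E × F) n) := isCompact_closedBall _ _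
    have hM : ∀ x : ℝ, ∫ ν in Metric.closedBall 0 n, ‖crSlice Φ f h ν x‖ ^ p ∂lebesgueN E F
        ≤ I.toReal := by
      intro x
      rw [← ENNReal.ofReal_le_iff_le_toReal hfin, hlint _ hs]
      simp only [crSlice_ofReal]
      -- The ball is not invariant under the shift by `x • h`, so the integral is enlarged to the
      -- whole space first.
      refine (setLIntegral_le_lintegral _ _).trans (le_of_eq ?_)
      exact lintegral_add_right_eq_self (μ := lebesgueN E F)
        (fun ν => ‖crRestrict Φ f 0 ν‖ₑ ^ p) (0, x • h)
    have hmain := setIntegral_norm_rpow_le_of_exponential_type (μ := lebesgueN E F)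
      (continuous_crSlice Φ hfc h) (differentiable_crSlice Φ hf.1 h) hs hp (a := a)
      (fun ε hε => by
        obtain ⟨C, hC, hCf⟩ := exists_norm_crSlice_le hf ha n hε
        exact ⟨C, hC, fun ν hν => hCf ν (mem_closedBall_zero_iff.1 hν)⟩) hM
    have h1 := ENNReal.ofReal_le_ofReal hmain
    rw [hlint _ hs, ENNReal.ofReal_mul (Real.exp_pos _).le, ENNReal.ofReal_toReal hfin] at h1
    simpa only [crSlice_I] using h1
  rw [← setLIntegral_univ, ← Metric.iUnion_closedBall_nat (0 : E × F),
    setLIntegral_iUnion_of_directed]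
  · exact iSup_le hball
  · exact Monotone.directed_le fun m n hmn =>
      Metric.closedBall_subset_closedBall (Nat.cast_le.2 hmn)

end PlancherelPolya

/-! ### The inequality for all exponents -/

theorem theorem1p7 {E F : Type*}
    [NormedAddCommGroup E] [InnerProductSpace ℂ E] [FiniteDimensional ℂ E]
    [MeasurableSpace E] [BorelSpace E]
    [NormedAddCommGroup F] [InnerProductSpace ℝ F] [FiniteDimensional ℝ F]
    [MeasurableSpace F] [BorelSpace F]
    (Φ : HermitianMap E F) (K : Set (StrongDual ℝ F)) (hK : IsCompact K) (hKc : Convex ℝ K)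
    (p : ℝ≥0∞) (hp : 0 < p)
    (f : E × Complexification F → ℂ) (hf : f ∈ bernsteinSpace Φ p K) (h : F) :
    eLpNorm (crRestrict Φ f h) p (lebesgueN E F) ≤
      EReal.exp (supportingFunction K h) *
        eLpNorm (crRestrict Φ f 0) p (lebesgueN E F) := by
  obtain ⟨hfK, hfp⟩ := hf
  rcases K.eq_empty_or_nonempty with rfl | hne
  -- The sum of `∅` and a ball is empty, so the growth bound contains the factor `EReal.exp ⊥ = 0`.
  · have hzero : ∀ w, f w = 0 := by
      rintro ⟨ζ, z⟩
      obtain ⟨C, -, hC⟩ := hfK.2 1 one_pos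
      simpa [supportingFunction] using hC ζ z
    have : crRestrict Φ f h = 0 := funext fun ν => hzero _
    simp [this]
  -- By compactness the supremum is attained, so it is a real number usable as the type `a`.
  obtain ⟨l, hl, hlmax⟩ := hK.neg.exists_isMaxOn hne.neg
    (f := fun l : StrongDual ℝ F => l h) (by fun_prop)
  have ha : ∀ l' ∈ -K, l' h ≤ l h := fun l' hl' => hlmax hl'
  have hexp : ENNReal.ofReal (Real.exp (l h)) ≤ EReal.exp (supportingFunction K h) := by
    rw [← EReal.exp_coe]
    exact EReal.exp_monotone (le_iSup₂ (f := fun (l : StrongDual ℝ F) (_ : l ∈ -K) =>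
      ((l h : ℝ) : EReal)) l hl)
  refine le_trans ?_ (mul_le_mul_left hexp _)
  rcases eq_or_ne p ∞ with rfl | hp'
  · have hfin := hfp.eLpNorm_ne_top
    rw [eLpNorm_exponent_top] at hfin
    -- The almost everywhere bound holds on a closed set of full measure, which is dense and hence
    -- everything.
    have hbd : ∀ ν, ‖crRestrict Φ f 0 ν‖ₑ ≤ eLpNormEssSup (crRestrict Φ f 0) (lebesgueN E F) := by
      have hcl : IsClosed {ν | ‖crRestrict Φ f 0 ν‖ₑ ≤
          eLpNormEssSup (crRestrict Φ f 0) (lebesgueN E F)} :=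
        isClosed_le (continuous_crRestrict Φ hfK.1.continuous 0).enorm continuous_const
      have hden := Measure.dense_of_ae (ae_le_eLpNormEssSup (f := crRestrict Φ f 0)
        (μ := lebesgueN E F))
      have huniv := hcl.closure_eq.symm.trans hden.closure_eq
      exact fun ν => huniv.ge (mem_univ ν)
    rw [eLpNorm_exponent_top, eLpNorm_exponent_top]
    refine eLpNormEssSup_le_of_ae_enorm_bound (ae_of_all _ fun ν => ?_)
    have h1 := norm_crRestrict_le hfK ha
      (fun ν => by simpa using ENNReal.toReal_mono hfin (hbd ν)) ν
    rw [← ofReal_norm]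
    refine (ENNReal.ofReal_le_ofReal h1).trans (le_of_eq ?_)
    rw [ENNReal.ofReal_mul (Real.exp_pos _).le, ENNReal.ofReal_toReal hfin]
  · have hp0 : 0 < p.toReal := ENNReal.toReal_pos hp.ne' hp'
    have hfin := lintegral_rpow_enorm_lt_top_of_eLpNorm_lt_top hp.ne' hp' hfp.2
    rw [eLpNorm_eq_lintegral_rpow_enorm_toReal hp.ne' hp',
      eLpNorm_eq_lintegral_rpow_enorm_toReal hp.ne' hp']
    calc _ ≤ (ENNReal.ofReal (Real.exp (p.toReal * l h)) *
          ∫⁻ ν, ‖crRestrict Φ f 0 ν‖ₑ ^ p.toReal ∂lebesgueN E F) ^ (1 / p.toReal) := by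
          gcongr
          exact lintegral_crRestrict_rpow_le hfK ha hp0 hfin.ne
      _ = _ := by
          rw [ENNReal.mul_rpow_of_nonneg _ _ (by positivity),
            ENNReal.ofReal_rpow_of_pos (Real.exp_pos _), ← Real.exp_mul]
          congr 3
          field_simp
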